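/- Let $G=\langle S\mid T\rangle$ be a finite presentation of a hyperbolic group, and for a word $w\in(S\sqcup S^{-1})^*$ write $\overline w\in G$ for its value and $w^{-1}$ for its formal inverse. Let $\mathcal L\subseteq(S\sqcup S^{-1})^*$ be a regular language, closed under prefixes and suffixes and consisting of geodesic words, such that for every $l\ge 1$ the words of length $l$ in $\mathcal L$ generate a finite-index subgroup of $G$. Let $R$ be a finite set of triples $(x,y,z)$ of non-empty reduced words in $\mathcal L$ such that each concatenation $xyz$ is reduced and lies in $\mathcal L$. Let $\mathcal R=\{xyz:(x,y,z)\in R\}$, let $\mathcal W(R)$ be the set of all words occurring in a triple of $R$, and suppose that $\mathcal W(R)$ generates a finite-index subgroup of $G$. Let $\Upsilon$ be the directed multigraph with vertex set $V=\mathcal W(R)\cup\{w^{-1}:w\in\mathcal W(R)\}$ in which each $(x,y,z)\in R$ contributes the two directed edges $(x,z^{-1})$ and $(z^{-1},x)$ (edges are counted with multiplicity). Let $A$ be its (symmetric) adjacency matrix, $D$ the diagonal matrix of degrees $\deg(w)$ = number of edges starting at $w$, and let $\lambda_1(\Upsilon)$ be the second smallest eigenvalue, counted with multiplicity, of $I-D^{-1/2}AD^{-1/2}$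 (where the entry of $D^{-1/2}$ at a vertex of degree $0$ is $0$, and $\lambda_1(\Upsilon):=0$ if $V=\emptyset$). For $w\in V$ let $\mathrm{rep}(w)=|\{(u,w,v)\in R\}|+|\{(u,w^{-1},v)\in R\}|$, and for $g\in G$ let $$\deg(g)=\sum_{w\in V,\ \overline w=g}\deg(w),\qquad \mathrm{rep}(g)=\sum_{w\in V,\ \overline w=g}\mathrm{rep}(w).$$ Suppose that $\epsilon,\delta>0$ are such that $4\epsilon^2<2$ and, for all $g\in G$ with $g=\overline w$ for some $w\in V$, $$\deg(g)\le(1+\epsilon)\deg(g^{-1})\quad\text{and}\quad \mathrm{rep}(g)\le(1+\delta)\deg(g).$$ If $$\lambda_1(\Upsilon)>\frac{1+\delta}{2-4\epsilon^2},$$ then $G/\langle\langle\mathcal R\rangle\rangle$ has Property (T): it is finitely generated, and every unitary representation of it on a complex Hilbert space with almost-invariant vectors has a non-zero invariant vector. -/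

import Mathlib

universe u v

/-! ### Property (T) -/

/-- The unitary representation `π` has almost-invariant vectors with respect to `S`. -/
def HasAlmostInvariantVectors {Γ : Type u} [Group Γ] (S : Set Γ) {H : Type v}
    [NormedAddCommGroup H] [InnerProductSpace ℂ H] (π : Γ →* (H ≃ₗᵢ[ℂ] H)) : Prop :=
  ∀ ε : ℝ, 0 < ε → ∃ x : H, x ≠ 0 ∧ ∀ s ∈ S, ‖π s x - x‖ < ε * ‖x‖

/-- Property (T) of a finitely generated group: for each finite generating set `S`, every unitary
representation on a complex Hilbert space with almost-invariant vectors (with respect to `S`) has a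
non-zero invariant vector. -/
def HasPropertyT (Γ : Type u) [Group Γ] : Prop :=
  Group.FG Γ ∧
  ∀ S : Finset Γ, Subgroup.closure (S : Set Γ) = ⊤ →
  ∀ (H : Type v) [NormedAddCommGroup H] [InnerProductSpace ℂ H] [CompleteSpace H]
    (π : Γ →* (H ≃ₗᵢ[ℂ] H)),
    HasAlmostInvariantVectors (S : Set Γ) π → ∃ x : H, x ≠ 0 ∧ ∀ g : Γ, π g x = x

/-! ### Finite directed multigraphs and their normalised Laplacian -/

/-- A directed graph with vertex type `V` and edge type `E`; loops and multiple edges allowed. -/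
structure DirectedMultigraph (V E : Type*) where
  src : E → V
  tgt : E → V

namespace DirectedMultigraph

variable {V E : Type*} [Fintype V] (Y : DirectedMultigraph V E)

/-- The number of edges that start at `w`. -/
noncomputable def deg (w : V) : ℕ := Nat.card {e : E // Y.src e = w}

/-- Entry `(i, j)` is the number of edges from `i` to `j`. -/
noncomputable def adjMatrix : Matrix V V ℝ :=
  fun i j => (Nat.card {e : E // Y.src e = i ∧ Y.tgt e = j} : ℝ)

open Classical in
/-- The diagonal matrix `D ^ (-1/2)`, where `D` is the matrix of degrees; the entry at a vertex
of degree `0` is `0`. -/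
noncomputable def degInvSqrt : Matrix V V ℝ :=
  Matrix.diagonal fun w => (Real.sqrt (Y.deg w))⁻¹

open Classical in
/-- `I - D ^ (-1/2) * A * D ^ (-1/2)`. -/
noncomputable def normLaplacian : Matrix V V ℝ :=
  1 - Y.degInvSqrt * Y.adjMatrix * Y.degInvSqrt

theorem isHermitian_normLaplacian
    (h : ∀ i j : V, Y.adjMatrix i j = Y.adjMatrix j i) : Y.normLaplacian.IsHermitian := by
  classical
  have hA : Y.adjMatrix.IsHermitian := by
    ext i j
    simp [Matrix.conjTranspose_apply, h j i]
  have hD : Y.degInvSqrt.conjTranspose = Y.degInvSqrt := by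
    simp [degInvSqrt]
  unfold normLaplacian
  refine Matrix.IsHermitian.sub (by convert Matrix.isHermitian_one) ?_
  have := Matrix.isHermitian_conjTranspose_mul_mul Y.degInvSqrt hA
  rwa [hD] at this

end DirectedMultigraph

open Classical in
/-- The second smallest eigenvalue (with multiplicity) `λ₁` of a symmetric real matrix with
eigenvalues `λ₀ ≤ λ₁ ≤ ⋯`; the value is `0` if the matrix has fewer than two rows.
Mathlib lists the eigenvalues in decreasing order. -/
noncomputable def secondSmallestEigenvalue {V : Type*} [Fintype V] {M : Matrix V V ℝ}
    (hM : M.IsHermitian) : ℝ :=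
  if h : 1 < Fintype.card V then hM.eigenvalues₀ (Fin.rev ⟨1, h⟩) else 0

/-! ### Finite presentations, word length, hyperbolicity -/

section Words

variable {α : Type u} (T : Set (FreeGroup α))

/-- The element of `⟨α | T⟩` represented by a word in the letters and their formal inverses. -/
def evalWord (w : List (α × Bool)) : PresentedGroup T :=
  PresentedGroup.mk T (FreeGroup.mk w)

/-- The word length on `⟨α | T⟩` with respect to the generators and their inverses. -/
noncomputable def wordLength (g : PresentedGroup T) : ℕ :=
  sInf {n : ℕ | ∃ w : List (α × Bool), evalWord T w = g ∧ w.length = n}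

/-- The word metric on `⟨α | T⟩`. -/
noncomputable def wordDist (g h : PresentedGroup T) : ℝ :=
  (wordLength T (g⁻¹ * h) : ℝ)

/-- Gromov hyperbolicity of `⟨α | T⟩`, as the four-point condition for the word metric. -/
def IsHyperbolicPresentation : Prop :=
  ∃ δ : ℝ, ∀ x y z w : PresentedGroup T,
    wordDist T x y + wordDist T z w ≤
      max (wordDist T x z + wordDist T y w) (wordDist T x w + wordDist T y z) + 2 * δ

/-- The requirements on the language: it is regular, closed under prefixes and suffixes, consists of
geodesic words, and for each `l ≥ 1` its words of length `l` generate a finite-index subgroup. -/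
structure IsAdmissibleLanguage (L : Language (α × Bool)) : Prop where
  regular : L.IsRegular
  prefix_closed : ∀ u v : List (α × Bool), u ++ v ∈ L → u ∈ L
  suffix_closed : ∀ u v : List (α × Bool), u ++ v ∈ L → v ∈ L
  geodesic : ∀ w : List (α × Bool), w ∈ L → w.length = wordLength T (evalWord T w)
  finiteIndex : ∀ l : ℕ, 1 ≤ l →
    (Subgroup.closure (evalWord T '' {w | w ∈ L ∧ w.length = l})).FiniteIndex

/-! ### The graph of a set of triples of words -/

/-- The requirements on the set `R` of triples `(x, y, z)` of words of the language. -/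
structure IsAdmissibleTriples (L : Language (α × Bool))
    (R : Finset (List (α × Bool) × List (α × Bool) × List (α × Bool))) : Prop where
  mem : ∀ r ∈ R, r.1 ∈ L ∧ r.2.1 ∈ L ∧ r.2.2 ∈ L
  ne_nil : ∀ r ∈ R, r.1 ≠ [] ∧ r.2.1 ≠ [] ∧ r.2.2 ≠ []
  reduced : ∀ r ∈ R, FreeGroup.IsReduced r.1 ∧ FreeGroup.IsReduced r.2.1 ∧
    FreeGroup.IsReduced r.2.2
  concat_mem : ∀ r ∈ R, r.1 ++ r.2.1 ++ r.2.2 ∈ L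
  concat_reduced : ∀ r ∈ R, FreeGroup.IsReduced (r.1 ++ r.2.1 ++ r.2.2)

variable (R : Finset (List (α × Bool) × List (α × Bool) × List (α × Bool)))

open Classical in
/-- The set `𝒲(R)` of all words that occur in a triple of `R`. -/
noncomputable def tripleWords : Finset (List (α × Bool)) :=
  R.image (fun r => r.1) ∪ R.image (fun r => r.2.1) ∪ R.image (fun r => r.2.2)

open Classical in
/-- The vertices of `Υ`: the words in `𝒲(R)` and their formal inverses. -/
noncomputable def upsilonVertices : Finset (List (α × Bool)) :=
  tripleWords R ∪ (tripleWords R).image FreeGroup.invRev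

theorem fst_mem_upsilonVertices {r : List (α × Bool) × List (α × Bool) × List (α × Bool)}
    (hr : r ∈ R) : r.1 ∈ upsilonVertices R := by
  classical
  exact Finset.mem_union_left _ (Finset.mem_union_left _
    (Finset.mem_union_left _ (Finset.mem_image_of_mem (fun r => r.1) hr)))

theorem inv_thd_mem_upsilonVertices {r : List (α × Bool) × List (α × Bool) × List (α × Bool)}
    (hr : r ∈ R) : FreeGroup.invRev r.2.2 ∈ upsilonVertices R := by
  classical
  exact Finset.mem_union_right _ (Finset.mem_image_of_mem _
    (Finset.mem_union_right _ (Finset.mem_image_of_mem (fun r => r.2.2) hr)))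

/-- The directed graph `Υ`: each triple `(x, y, z)` of `R` contributes the two directed edges
`(x, z⁻¹)` (index `false`) and `(z⁻¹, x)` (index `true`). -/
noncomputable def upsilon :
    DirectedMultigraph {w // w ∈ upsilonVertices R} ({r // r ∈ R} × Bool) where
  src e := bif e.2 then ⟨FreeGroup.invRev e.1.1.2.2, inv_thd_mem_upsilonVertices R e.1.2⟩
    else ⟨e.1.1.1, fst_mem_upsilonVertices R e.1.2⟩
  tgt e := bif e.2 then ⟨e.1.1.1, fst_mem_upsilonVertices R e.1.2⟩
    else ⟨FreeGroup.invRev e.1.1.2.2, inv_thd_mem_upsilonVertices R e.1.2⟩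

theorem upsilon_adjMatrix_symm (i j : {w // w ∈ upsilonVertices R}) :
    (upsilon R).adjMatrix i j = (upsilon R).adjMatrix j i := by
  unfold DirectedMultigraph.adjMatrix
  congr 1
  refine Nat.card_congr
    { toFun := fun e => ⟨(e.1.1, !e.1.2), ?_⟩
      invFun := fun e => ⟨(e.1.1, !e.1.2), ?_⟩
      left_inv := fun e => by simp
      right_inv := fun e => by simp }
  · obtain ⟨⟨r, b⟩, h⟩ := e
    cases b <;> exact ⟨h.2, h.1⟩
  · obtain ⟨⟨r, b⟩, h⟩ := e
    cases b <;> exact ⟨h.2, h.1⟩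

/-- `λ₁(Υ)`: the second smallest eigenvalue of the normalised Laplacian of `Υ`. -/
noncomputable def upsilonLambdaOne : ℝ :=
  secondSmallestEigenvalue
    ((upsilon R).isHermitian_normLaplacian (upsilon_adjMatrix_symm R))

/-- `rep(w)`: the number of triples with middle word `w` plus the number of triples with middle
word `w⁻¹`. -/
noncomputable def wordRep (w : List (α × Bool)) : ℕ :=
  Nat.card {r // r ∈ R ∧ r.2.1 = w} + Nat.card {r // r ∈ R ∧ r.2.1 = FreeGroup.invRev w}

open Classical in
/-- `deg(g)`: the sum of the degrees in `Υ` of the vertices that represent `g`. -/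
noncomputable def groupDeg (g : PresentedGroup T) : ℕ :=
  ∑ w : {w // w ∈ upsilonVertices R} with evalWord T w.1 = g, (upsilon R).deg w

open Classical in
/-- `rep(g)`: the sum of `rep(w)` over the vertices `w` of `Υ` that represent `g`. -/
noncomputable def groupRep (g : PresentedGroup T) : ℕ :=
  ∑ w : {w // w ∈ upsilonVertices R} with evalWord T w.1 = g, wordRep R w.1

/-- The relators `xyz`, as elements of `⟨α | T⟩`. -/
def tripleRelators : Set (PresentedGroup T) :=
  {g | ∃ r ∈ R, g = evalWord T (r.1 ++ r.2.1 ++ r.2.2)}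

end Words

/-! Let `v` be a vector in an orthogonal representation of `G` that kills the relators, put `b(g) =
π(g)v - v`, and let `A` be the degree-weighted Laplacian over the vertices of `Υ`. Then `E = ⟨Av,
v⟩` is the weighted sum of the `‖b(w)‖²`.

Apply the Poincaré inequality of `Υ` to `w ↦ b(w)` (`DirectedMultigraph.poincare`). Since `xyz` acts
trivially, `z⁻¹` acts as `xy`, so the edge of `(x, y, z)` has length `‖b(y)‖`, and the bound on
`rep` controls the edge energy by `(1 + δ)E` (`sum_edges_norm_sq`). If degrees were symmetric under
inversion, the weighted sum of `b` would be `-Av/2`; near-symmetry costs a term in `ε`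
(`norm_sum_deg_smul_sq_le`). With `D` the total degree this gives `(λ₁(2 - ε²) - (1 + δ)) D E ≤
λ₁‖Av‖²` (`mul_inner_upsilonLaplacian_le`), that is, `ηA ≤ A²` with `η > 0` independent of `v` and
of the representation.

Hence `A ≥ η` on the orthogonal complement of `ker A`
(`mul_norm_sq_le_inner_of_mem_orthogonal_ker`), so an almost-invariant vector lies close to `ker A`.
That kernel is fixed by the finite-index subgroup generated by `𝒲(R)`; summing over its cosets
yields a non-zero invariant vector (`exists_invariant_of_finiteIndex_of_gap`). -/

open scoped InnerProductSpace

/-! ### Spectral decomposition of real symmetric matrices, with Hilbert-space coefficients -/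

namespace Matrix.IsHermitian

variable {V : Type*} [Fintype V] [DecidableEq V] {M : Matrix V V ℝ}

theorem sum_eigenvectorBasis_mul (hM : M.IsHermitian) (j k : V) :
    ∑ i, hM.eigenvectorBasis i j * hM.eigenvectorBasis i k = if j = k then 1 else 0 := by
  have h := Unitary.coe_mul_star_self hM.eigenvectorUnitary
  have := congrFun (congrFun h j) k
  simpa [Matrix.mul_apply, Matrix.one_apply] using this

theorem apply_eq_sum_eigenvalues_mul (hM : M.IsHermitian) (j k : V) :
    M j k = ∑ i, hM.eigenvalues i * (hM.eigenvectorBasis i j * hM.eigenvectorBasis i k) := by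
  have h := congrFun (congrFun hM.spectral_theorem j) k
  rw [h, Unitary.conjStarAlgAut_apply, Matrix.mul_apply]
  refine Finset.sum_congr rfl fun i _ => ?_
  simp [Matrix.mul_diagonal]
  ring

variable {H : Type*} [NormedAddCommGroup H] [InnerProductSpace ℝ H]

theorem sum_eigenvalues_mul_norm_sq (hM : M.IsHermitian) (f : V → H) :
    ∑ i, hM.eigenvalues i * ‖∑ j, hM.eigenvectorBasis i j • f j‖ ^ 2 =
      ∑ j, ∑ k, M j k * ⟪f j, f k⟫_ℝ := by
  simp_rw [← real_inner_self_eq_norm_sq, sum_inner, inner_sum, real_inner_smul_left,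
    real_inner_smul_right, hM.apply_eq_sum_eigenvalues_mul, Finset.mul_sum, Finset.sum_mul]
  rw [Finset.sum_comm]
  refine Finset.sum_congr rfl fun j _ => ?_
  rw [Finset.sum_comm]
  exact Finset.sum_congr rfl fun k _ => Finset.sum_congr rfl fun i _ => by ring

/-- Parseval's identity for vector-valued functions: the matrix of eigenvectors is orthogonal. -/
theorem sum_norm_sq_eigenvectorBasis (hM : M.IsHermitian) (f : V → H) :
    ∑ i, ‖∑ j, hM.eigenvectorBasis i j • f j‖ ^ 2 = ∑ j, ‖f j‖ ^ 2 := by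
  simp_rw [← real_inner_self_eq_norm_sq, sum_inner, inner_sum, real_inner_smul_left,
    real_inner_smul_right]
  rw [Finset.sum_comm]
  refine Finset.sum_congr rfl fun j _ => ?_
  rw [Finset.sum_comm]
  have (k : V) : ∑ i, hM.eigenvectorBasis i j * (hM.eigenvectorBasis i k * ⟪f j, f k⟫_ℝ) =
      if j = k then ⟪f j, f k⟫_ℝ else 0 := by
    simp_rw [← mul_assoc, ← Finset.sum_mul, hM.sum_eigenvectorBasis_mul]
    simp
  simp [this]

end Matrix.IsHermitian

/-- All eigenvalues but one are at least the second smallest eigenvalue, if that is positive. -/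
theorem exists_secondSmallestEigenvalue_le {V : Type*} [Fintype V] [DecidableEq V]
    {M : Matrix V V ℝ} (hM : M.IsHermitian) (hpos : 0 < secondSmallestEigenvalue hM) :
    ∃ i₀, ∀ i, i ≠ i₀ → secondSmallestEigenvalue hM ≤ hM.eigenvalues i := by
  classical
  have hc : 1 < Fintype.card V := by
    by_contra h
    simp [secondSmallestEigenvalue, h] at hpos
  -- This is the bijection through which `eigenvalues` is defined from `eigenvalues₀`. The order is
  -- decreasing, so the smallest eigenvalue sits at the last index.
  let e : Fin (Fintype.card V) ≃ V := Fintype.equivOfCardEq (Fintype.card_fin _)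
  refine ⟨e (Fin.rev ⟨0, by omega⟩), fun i hi => ?_⟩
  have hne : e.symm i ≠ Fin.rev ⟨0, by omega⟩ := fun h => hi (by rw [← h]; simp)
  have hle : e.symm i ≤ Fin.rev ⟨1, hc⟩ := by
    rw [Ne, Fin.ext_iff, Fin.val_rev] at hne
    rw [Fin.le_def, Fin.val_rev]
    have := (e.symm i).2
    simp only at hne ⊢
    omega
  have := hM.eigenvalues₀_antitone hle
  unfold secondSmallestEigenvalue
  rw [dif_pos hc]
  exact this

/-- A Poincaré inequality: the second smallest eigenvalue bounds the quadratic form off a null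
vector. -/
theorem secondSmallestEigenvalue_mul_le {V : Type*} [Fintype V]
    {M : Matrix V V ℝ} (hM : M.IsHermitian) (hpos : 0 < secondSmallestEigenvalue hM)
    {φ : V → ℝ} (hφ : M.mulVec φ = 0) (hφ0 : 0 < ∑ j, φ j ^ 2)
    {H : Type*} [NormedAddCommGroup H] [InnerProductSpace ℝ H] (f : V → H) :
    secondSmallestEigenvalue hM *
        (∑ j, ‖f j‖ ^ 2 - ‖∑ j, φ j • f j‖ ^ 2 / ∑ j, φ j ^ 2) ≤
      ∑ j, ∑ k, M j k * ⟪f j, f k⟫_ℝ := by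
  classical
  obtain ⟨i₀, hi₀⟩ := exists_secondSmallestEigenvalue_le hM hpos
  set e := hM.eigenvectorBasis
  let p : V → ℝ := fun i => ∑ k, e i k * φ k
  -- Pairing `Mφ = 0` with the `i`-th eigenvector. Only `i₀` can have an eigenvalue that is not
  -- positive, so `φ` is a multiple of that eigenvector.
  have hmul (i : V) : hM.eigenvalues i * p i = 0 := by
    have h1 := hM.mulVec_eigenvectorBasis i
    have h2 : (M.mulVec (e i)) ⬝ᵥ φ = 0 := by
      have hT : M.transpose = M := by simpa [Matrix.IsHermitian] using hM
      rw [← hT, Matrix.mulVec_transpose, ← Matrix.dotProduct_mulVec, hφ, dotProduct_zero]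
    rw [h1] at h2
    simpa [dotProduct, p, Finset.mul_sum, mul_assoc] using h2
  have hp (i : V) (hi : i ≠ i₀) : p i = 0 :=
    (mul_eq_zero.1 (hmul i)).resolve_left (hpos.trans_le (hi₀ i hi)).ne'
  have hφe (j : V) : φ j = p i₀ * e i₀ j := by
    have h1 : φ j = ∑ i, p i * e i j := by
      simp_rw [p, Finset.sum_mul]
      rw [Finset.sum_comm]
      have (k : V) : ∑ i, e i k * φ k * e i j = if k = j then φ k else 0 := by
        calc _ = ∑ i, (e i k * e i j) * φ k := Finset.sum_congr rfl fun i _ => by ring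
          _ = _ := by rw [← Finset.sum_mul, hM.sum_eigenvectorBasis_mul]; simp
      simp [this]
    rw [h1, Finset.sum_eq_single i₀ (fun i _ hi => by rw [hp i hi, zero_mul]) (by simp)]
  have hnorm : ∑ j, e i₀ j ^ 2 = 1 := by
    have := e.orthonormal.1 i₀
    rw [EuclideanSpace.norm_eq, Real.sqrt_eq_one] at this
    simpa using this
  have hsq : ∑ j, φ j ^ 2 = p i₀ ^ 2 := by
    simp_rw [hφe, mul_pow, ← Finset.mul_sum, hnorm, mul_one]
  have hdiv : ‖∑ j, φ j • f j‖ ^ 2 / ∑ j, φ j ^ 2 = ‖∑ j, e i₀ j • f j‖ ^ 2 := by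
    rw [hsq] at hφ0 ⊢
    have hp0 : p i₀ ≠ 0 := fun h => by simp [h] at hφ0
    simp_rw [hφe, mul_smul, ← Finset.smul_sum, norm_smul, mul_pow, Real.norm_eq_abs, sq_abs]
    field_simp
  rw [hdiv, ← hM.sum_eigenvalues_mul_norm_sq, ← hM.sum_norm_sq_eigenvectorBasis,
    ← Finset.add_sum_erase _ _ (Finset.mem_univ i₀), add_sub_cancel_left]
  rw [← Finset.add_sum_erase _ (fun i => hM.eigenvalues i * _) (Finset.mem_univ i₀)]
  have hzero : hM.eigenvalues i₀ = 0 := by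
    refine (mul_eq_zero.1 (hmul i₀)).resolve_right fun h => ?_
    simp [hsq, h] at hφ0
  rw [hzero, zero_mul, zero_add, Finset.mul_sum]
  exact Finset.sum_le_sum fun i hi =>
    mul_le_mul_of_nonneg_right (hi₀ i (Finset.ne_of_mem_erase hi)) (sq_nonneg _)

/-! ### The normalised Laplacian of a graph and its Poincaré inequality -/

namespace DirectedMultigraph

variable {V E : Type*} [Fintype V] [Fintype E] (Y : DirectedMultigraph V E)

theorem sum_deg_smul {X : Type*} [AddCommGroup X] [Module ℝ X] (F : V → X) :
    ∑ w, (Y.deg w : ℝ) • F w = ∑ e, F (Y.src e) := by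
  classical
  rw [← Finset.sum_fiberwise_of_maps_to (fun e _ => Finset.mem_univ (Y.src e))]
  refine Finset.sum_congr rfl fun w _ => ?_
  rw [Finset.sum_congr rfl (g := fun _ => F w) fun e he => by rw [(Finset.mem_filter.1 he).2],
    Finset.sum_const, deg, Nat.card_eq_fintype_card, Fintype.card_subtype, Nat.cast_smul_eq_nsmul]

theorem sum_deg_mul (F : V → ℝ) : ∑ w, (Y.deg w : ℝ) * F w = ∑ e, F (Y.src e) :=
  Y.sum_deg_smul F

theorem sum_adjMatrix_mul (F : V → V → ℝ) :
    ∑ i, ∑ j, Y.adjMatrix i j * F i j = ∑ e, F (Y.src e) (Y.tgt e) := by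
  classical
  rw [← Fintype.sum_prod_type', ← Finset.sum_fiberwise_of_maps_to
    (fun e _ => Finset.mem_univ (Y.src e, Y.tgt e))]
  refine Finset.sum_congr rfl fun w _ => ?_
  rw [Finset.sum_congr rfl (g := fun _ => F w.1 w.2) fun e he => by
      rw [← (Finset.mem_filter.1 he).2],
    Finset.sum_const, adjMatrix, Nat.card_eq_fintype_card, Fintype.card_subtype, nsmul_eq_mul]
  simp [Prod.ext_iff]

theorem sum_adjMatrix_row (i : V) : ∑ j, Y.adjMatrix i j = Y.deg i := by
  classical
  have h1 := Y.sum_adjMatrix_mul (fun a _ => if a = i then 1 else 0)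
  have h2 := Y.sum_deg_mul (fun a => if a = i then 1 else 0)
  simp only [mul_ite, mul_one, mul_zero, Finset.sum_ite_eq', Finset.mem_univ, if_true] at h2
  rw [h2, ← h1, Finset.sum_comm]
  simp

theorem adjMatrix_eq_zero_of_deg_eq_zero {i : V} (h : Y.deg i = 0) (j : V) :
    Y.adjMatrix i j = 0 := by
  have h1 := Y.sum_adjMatrix_row i
  rw [h, Nat.cast_zero] at h1
  exact (Finset.sum_eq_zero_iff_of_nonneg (f := fun j => Y.adjMatrix i j)
    fun j _ => Nat.cast_nonneg _).1 h1 j (Finset.mem_univ j)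

omit [Fintype E] in
theorem normLaplacian_apply [DecidableEq V] (i j : V) : Y.normLaplacian i j =
    (if i = j then 1 else 0) - (√(Y.deg i))⁻¹ * Y.adjMatrix i j * (√(Y.deg j))⁻¹ := by
  simp [normLaplacian, degInvSqrt, Matrix.mul_diagonal, Matrix.diagonal_mul, Matrix.one_apply]

theorem sqrt_deg_mul_normLaplacian (hA : ∀ i j, Y.adjMatrix i j = Y.adjMatrix j i)
    [DecidableEq V] (i j : V) :
    √(Y.deg i) * Y.normLaplacian i j * √(Y.deg j) =
      (if i = j then (Y.deg i : ℝ) else 0) - Y.adjMatrix i j := by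
  -- At a vertex of degree `0` nothing can be cancelled, but there the row and column of the
  -- adjacency matrix vanish.
  have key : √(Y.deg i) * ((√(Y.deg i))⁻¹ * Y.adjMatrix i j * (√(Y.deg j))⁻¹) * √(Y.deg j) =
      Y.adjMatrix i j := by
    rcases eq_or_ne (Y.deg i) 0 with hi | hi
    · simp [Y.adjMatrix_eq_zero_of_deg_eq_zero hi]
    rcases eq_or_ne (Y.deg j) 0 with hj | hj
    · simp [hA i j, Y.adjMatrix_eq_zero_of_deg_eq_zero hj]
    have hi' : √(Y.deg i : ℝ) ≠ 0 := by positivity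
    have hj' : √(Y.deg j : ℝ) ≠ 0 := by positivity
    field_simp
  rw [normLaplacian_apply, mul_sub, sub_mul, key]
  split_ifs with h
  · subst h; simp
  · simp

theorem normLaplacian_mulVec_sqrt_deg (hA : ∀ i j, Y.adjMatrix i j = Y.adjMatrix j i) :
    Y.normLaplacian.mulVec (fun w => √(Y.deg w)) = 0 := by
  classical
  funext i
  have h (j : V) : Y.normLaplacian i j * √(Y.deg j) =
      (if i = j then √(Y.deg j) else 0) - (√(Y.deg i))⁻¹ * Y.adjMatrix i j := by
    rw [normLaplacian_apply, sub_mul, ite_mul, one_mul, zero_mul]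
    congr 1
    rcases eq_or_ne (Y.deg j) 0 with hj | hj
    · simp [hA i j, Y.adjMatrix_eq_zero_of_deg_eq_zero hj]
    have hj' : √(Y.deg j : ℝ) ≠ 0 := by positivity
    rw [inv_mul_cancel_right₀ hj']
  simp only [Matrix.mulVec, dotProduct, h, Finset.sum_sub_distrib, ← Finset.mul_sum,
    Y.sum_adjMatrix_row, Finset.sum_ite_eq, Finset.mem_univ, if_true, Pi.zero_apply]
  rw [sub_eq_zero, inv_mul_eq_div, Real.div_sqrt]

/-- The Poincaré inequality of a finite graph, for functions with values in a Hilbert space. -/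
theorem poincare (hA : ∀ i j, Y.adjMatrix i j = Y.adjMatrix j i)
    (hpos : 0 < secondSmallestEigenvalue (Y.isHermitian_normLaplacian hA))
    (hdeg : 0 < ∑ w, (Y.deg w : ℝ))
    {H : Type*} [NormedAddCommGroup H] [InnerProductSpace ℝ H] (f : V → H) :
    secondSmallestEigenvalue (Y.isHermitian_normLaplacian hA) *
        (∑ w, (Y.deg w : ℝ) * ‖f w‖ ^ 2 -
          ‖∑ w, (Y.deg w : ℝ) • f w‖ ^ 2 / ∑ w, (Y.deg w : ℝ)) ≤
      (∑ e, ‖f (Y.src e) - f (Y.tgt e)‖ ^ 2) / 2 := by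
  classical
  have hs (w : V) : √(Y.deg w : ℝ) ^ 2 = Y.deg w := Real.sq_sqrt (Nat.cast_nonneg _)
  -- Rescaling `f` by `√deg` turns the normalised Laplacian into `D - A`, and the constants into its
  -- null vector `√deg`.
  have h := secondSmallestEigenvalue_mul_le (Y.isHermitian_normLaplacian hA) hpos
    (Y.normLaplacian_mulVec_sqrt_deg hA) (by simpa only [hs] using hdeg)
    (fun w => √(Y.deg w : ℝ) • f w)
  simp only [norm_smul, mul_pow, Real.norm_eq_abs, sq_abs, hs, smul_smul, ← pow_two] at h
  refine h.trans_eq ?_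
  have hterm (j k : V) : Y.normLaplacian j k * ⟪√(Y.deg j : ℝ) • f j, √(Y.deg k : ℝ) • f k⟫_ℝ =
      (if j = k then (Y.deg j : ℝ) * ‖f j‖ ^ 2 else 0) - Y.adjMatrix j k * ⟪f j, f k⟫_ℝ := by
    rw [real_inner_smul_left, real_inner_smul_right]
    trans (√(Y.deg j) * Y.normLaplacian j k * √(Y.deg k)) * ⟪f j, f k⟫_ℝ
    · ring
    rw [Y.sqrt_deg_mul_normLaplacian hA, sub_mul]
    split_ifs with hjk
    · rw [hjk, real_inner_self_eq_norm_sq]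
    · rw [zero_mul]
  have htgt : ∑ e, ‖f (Y.tgt e)‖ ^ 2 = ∑ w, (Y.deg w : ℝ) * ‖f w‖ ^ 2 := by
    rw [← Y.sum_adjMatrix_mul (fun _ j => ‖f j‖ ^ 2), Finset.sum_comm]
    refine Finset.sum_congr rfl fun j _ => ?_
    simp_rw [hA _ j]
    rw [← Finset.sum_mul, Y.sum_adjMatrix_row]
  simp only [hterm, Finset.sum_sub_distrib, Y.sum_adjMatrix_mul (fun i j => ⟪f i, f j⟫_ℝ),
    Finset.sum_ite_eq, Finset.mem_univ, if_true, norm_sub_sq_real, Finset.sum_add_distrib, htgt,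
    ← Y.sum_deg_mul (fun w => ‖f w‖ ^ 2), ← Finset.mul_sum]
  ring

end DirectedMultigraph

/-! ### From an operator inequality to invariant vectors -/

/-- If `η A ≤ A²` for a positive symmetric operator `A`, then `η ≤ A` off the kernel of `A`. -/
theorem mul_norm_sq_le_inner_of_mem_orthogonal_ker {H : Type*} [NormedAddCommGroup H]
    [InnerProductSpace ℝ H] [CompleteSpace H] (A : H →L[ℝ] H)
    (hsymm : ∀ u v, ⟪A u, v⟫_ℝ = ⟪u, A v⟫_ℝ) (hpos : ∀ v, 0 ≤ ⟪A v, v⟫_ℝ) {η : ℝ} (hη : 0 < η)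
    (h : ∀ v, η * ⟪A v, v⟫_ℝ ≤ ‖A v‖ ^ 2) (u : H) (hu : u ∈ A.kerᗮ) :
    η * ‖u‖ ^ 2 ≤ ⟪A u, u⟫_ℝ := by
  -- Cauchy–Schwarz for the semi-definite form of `A`: the quadratic `t ↦ ⟨A(x + ty), x + ty⟩` is
  -- nonnegative.
  have hcs (x y : H) : ⟪A x, y⟫_ℝ ^ 2 ≤ ⟪A x, x⟫_ℝ * ⟪A y, y⟫_ℝ := by
    have hd := discrim_le_zero (a := ⟪A y, y⟫_ℝ) (b := 2 * ⟪A x, y⟫_ℝ) (c := ⟪A x, x⟫_ℝ)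
      fun t => by
        have h1 := hpos (x + t • y)
        have h2 : ⟪A y, x⟫_ℝ = ⟪A x, y⟫_ℝ := by rw [hsymm, real_inner_comm]
        simp only [map_add, map_smul, inner_add_left, inner_add_right, real_inner_smul_left,
          real_inner_smul_right, h2] at h1
        linarith
    rw [discrim] at hd
    nlinarith
  -- Taking `y = Av` gives `‖Av‖⁴ ≤ ⟨Av, v⟩⟨A²v, Av⟩`; multiply by `η`, apply `h` and cancel
  -- `‖Av‖²`.
  have hrange (v : H) : η * ‖A v‖ ^ 2 ≤ ⟪A (A v), A v⟫_ℝ := by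
    rcases eq_or_ne (A v) 0 with h0 | h0
    · simp [h0]
    have h1 := hcs v (A v)
    rw [real_inner_self_eq_norm_sq] at h1
    have h2 : 0 < ‖A v‖ ^ 2 := by positivity
    have h3 := mul_le_mul_of_nonneg_right (h v) (hpos (A v))
    have h4 := mul_le_mul_of_nonneg_left h1 hη.le
    refine le_of_mul_le_mul_left ?_ h2
    nlinarith
  have hself : ContinuousLinearMap.adjoint A = A :=
    (ContinuousLinearMap.eq_adjoint_iff A A).2 hsymm |>.symm
  have hcl : u ∈ closure (Set.range A) := by
    rw [ContinuousLinearMap.orthogonal_ker, hself] at hu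
    rw [← SetLike.mem_coe, Submodule.topologicalClosure_coe] at hu
    convert hu
    ext; simp
  have hclosed : IsClosed {u : H | η * ‖u‖ ^ 2 ≤ ⟪A u, u⟫_ℝ} :=
    isClosed_le (by fun_prop) (by fun_prop)
  exact closure_minimal (by rintro _ ⟨v, rfl⟩; exact hrange v) hclosed hcl

theorem linearIsometryEquiv_map_mul_apply {Γ : Type*} [Group Γ] {H : Type*} [NormedAddCommGroup H]
    [InnerProductSpace ℝ H] (π : Γ →* (H ≃ₗᵢ[ℝ] H)) (a b : Γ) (x : H) :
    π (a * b) x = π a (π b x) := by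
  rw [map_mul]; rfl

theorem linearIsometryEquiv_inner_map_inv {Γ : Type*} [Group Γ] {H : Type*} [NormedAddCommGroup H]
    [InnerProductSpace ℝ H] (π : Γ →* (H ≃ₗᵢ[ℝ] H)) (g : Γ) (u v : H) :
    ⟪π g⁻¹ u, v⟫_ℝ = ⟪u, π g v⟫_ℝ := by
  rw [← (π g).inner_map_map, ← linearIsometryEquiv_map_mul_apply]; simp

/-- Displacement by a fixed element is controlled by displacement by generators. -/
theorem exists_norm_map_sub_le {Γ : Type*} [Group Γ] {H : Type*} [NormedAddCommGroup H]
    [InnerProductSpace ℝ H] (π : Γ →* (H ≃ₗᵢ[ℝ] H)) {S : Set Γ} (hS : Subgroup.closure S = ⊤)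
    (g : Γ) : ∃ C : ℝ, 0 ≤ C ∧ ∀ (x : H) (ε : ℝ), 0 ≤ ε → (∀ s ∈ S, ‖π s x - x‖ ≤ ε) →
      ‖π g x - x‖ ≤ C * ε := by
  have hg : g ∈ Subgroup.closure S := hS ▸ Subgroup.mem_top g
  induction hg using Subgroup.closure_induction with
  | mem s hs => exact ⟨1, zero_le_one, fun x ε _ h => by simpa using h s hs⟩
  | one => exact ⟨0, le_rfl, fun x ε _ _ => by simp⟩
  | mul a b _ _ ha hb =>
    obtain ⟨C, hC, h1⟩ := ha
    obtain ⟨D, hD, h2⟩ := hb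
    refine ⟨C + D, add_nonneg hC hD, fun x ε hε h => ?_⟩
    have : π (a * b) x - x = π a (π b x - x) + (π a x - x) := by
      rw [linearIsometryEquiv_map_mul_apply, map_sub]; abel
    rw [this]
    refine (norm_add_le _ _).trans ?_
    rw [LinearIsometryEquiv.norm_map]
    linarith [h1 x ε hε h, h2 x ε hε h]
  | inv a _ ha =>
    obtain ⟨C, hC, h1⟩ := ha
    refine ⟨C, hC, fun x ε hε h => ?_⟩
    have : π a⁻¹ x - x = - π a⁻¹ (π a x - x) := by
      rw [map_sub, ← linearIsometryEquiv_map_mul_apply]; simp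
    rw [this, norm_neg, LinearIsometryEquiv.norm_map]
    exact h1 x ε hε h

/-- A uniform displacement gap on the complement of a closed space of vectors invariant under a
finite-index subgroup turns almost-invariant vectors into an invariant vector. -/
theorem exists_invariant_of_finiteIndex_of_gap {Γ : Type*} [Group Γ] {H : Type*}
    [NormedAddCommGroup H] [InnerProductSpace ℝ H] [CompleteSpace H] (π : Γ →* (H ≃ₗᵢ[ℝ] H))
    {S : Set Γ} (hS : Subgroup.closure S = ⊤)
    (halmost : ∀ ε : ℝ, 0 < ε → ∃ x : H, x ≠ 0 ∧ ∀ s ∈ S, ‖π s x - x‖ < ε * ‖x‖)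
    (N : Subgroup Γ) [N.FiniteIndex] (K : Submodule ℝ H) [K.HasOrthogonalProjection]
    (hK : ∀ k ∈ K, ∀ n ∈ N, π n k = k)
    {ι : Type*} [Fintype ι] (g : ι → Γ) (hg : ∀ i, g i ∈ N) (c : ι → ℝ) (hc : ∀ i, 0 ≤ c i)
    {η : ℝ} (hη : 0 < η)
    (hgap : ∀ u ∈ Kᗮ, η * ‖u‖ ^ 2 ≤ ∑ i, c i * ‖π (g i) u - u‖ ^ 2) :
    ∃ x : H, x ≠ 0 ∧ ∀ γ : Γ, π γ x = x := by
  classical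
  choose C hC0 hC using exists_norm_map_sub_le π hS
  have : Fintype (Γ ⧸ N) := Fintype.ofFinite _
  set B : ℝ := ∑ i, c i * C (g i) ^ 2 with hB
  set D : ℝ := ∑ q : Γ ⧸ N, C q.out with hD
  have hB0 : 0 ≤ B := Finset.sum_nonneg fun i _ => mul_nonneg (hc i) (sq_nonneg _)
  have hD0 : 0 ≤ D := Finset.sum_nonneg fun q _ => hC0 _
  set n : ℝ := (Fintype.card (Γ ⧸ N) : ℝ) with hn
  have hn0 : 0 < n := by
    have : 0 < Fintype.card (Γ ⧸ N) := Fintype.card_pos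
    exact Nat.cast_pos.2 this
  obtain ⟨ε, hε, hεb⟩ : ∃ ε : ℝ, 0 < ε ∧ ε * (√(B / η) * n + D) < n := by
    have hpos : 0 < √(B / η) * n + D + 1 := by positivity
    refine ⟨n / (√(B / η) * n + D + 1), by positivity, ?_⟩
    rw [div_mul_eq_mul_div, div_lt_iff₀ hpos]
    nlinarith
  obtain ⟨x, hx0, hx⟩ := halmost ε hε
  have hxn : 0 < ‖x‖ := norm_pos_iff.2 hx0
  have hxC (γ : Γ) : ‖π γ x - x‖ ≤ C γ * (ε * ‖x‖) :=
    hC γ x _ (by positivity) fun s hs => (hx s hs).le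
  obtain ⟨k, hk, u, hu, rfl⟩ := K.exists_add_mem_mem_orthogonal x
  -- Each `g i` fixes `k`, so it displaces `u` exactly as much as `x = k + u`; the gap then makes
  -- `u` small.
  have hun : ‖u‖ ≤ √(B / η) * (ε * ‖k + u‖) := by
    have h1 : η * ‖u‖ ^ 2 ≤ B * (ε * ‖k + u‖) ^ 2 := by
      refine (hgap u hu).trans ?_
      rw [hB, Finset.sum_mul]
      refine Finset.sum_le_sum fun i _ => ?_
      rw [mul_assoc, ← mul_pow]
      refine mul_le_mul_of_nonneg_left (pow_le_pow_left₀ (norm_nonneg _) ?_ 2) (hc i)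
      have := hxC (g i)
      rwa [map_add, hK k hk _ (hg i), add_sub_add_left_eq_sub] at this
    rw [← abs_of_nonneg (norm_nonneg u),
      ← abs_of_nonneg (show 0 ≤ √(B / η) * (ε * ‖k + u‖) by positivity), ← sq_le_sq, mul_pow,
      Real.sq_sqrt (by positivity), div_mul_eq_mul_div, le_div_iff₀ hη]
    linarith
  -- As `k` is fixed by `N`, the vector `π g k` depends only on the coset `gN`, and `γ` permutes
  -- these vectors.
  have hinv (γ : Γ) (q : Γ ⧸ N) : π γ (π q.out k) = π (γ • q).out k := by
    have hmem : (γ • q).out⁻¹ * (γ * q.out) ∈ N := by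
      rw [← QuotientGroup.eq]
      calc ((γ • q).out : Γ ⧸ N) = γ • ((q.out : Γ) : Γ ⧸ N) := by
            rw [QuotientGroup.out_eq', QuotientGroup.out_eq']
        _ = _ := rfl
    have h1 := hK k hk _ hmem
    rw [← linearIsometryEquiv_map_mul_apply]
    conv_rhs => rw [← h1, ← linearIsometryEquiv_map_mul_apply]
    rw [mul_inv_cancel_left]
  refine ⟨∑ q : Γ ⧸ N, π q.out k, fun h0 => ?_, fun γ => ?_⟩
  -- If the coset sum of `k` vanished, `n • x` would be a sum of displacements of `x` and translates
  -- of `u`, too short by the choice of `ε`.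
  · have h1 : n • (k + u) = -∑ q : Γ ⧸ N, (π q.out (k + u) - (k + u) - π q.out u) := by
      simp only [map_add, Finset.sum_sub_distrib, Finset.sum_add_distrib, h0, Finset.sum_const,
        Finset.card_univ, hn, Nat.cast_smul_eq_nsmul, smul_add]
      abel
    have h2 : n * ‖k + u‖ ≤ ε * (√(B / η) * n + D) * ‖k + u‖ := by
      calc n * ‖k + u‖ = ‖n • (k + u)‖ := by rw [norm_smul, Real.norm_of_nonneg hn0.le]
        _ ≤ ∑ q : Γ ⧸ N, ‖π q.out (k + u) - (k + u) - π q.out u‖ := by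
          rw [h1, norm_neg]; exact norm_sum_le _ _
        _ ≤ ∑ q : Γ ⧸ N, (C q.out * (ε * ‖k + u‖) + √(B / η) * (ε * ‖k + u‖)) := by
          refine Finset.sum_le_sum fun q _ => (norm_sub_le _ _).trans (add_le_add (hxC _) ?_)
          rwa [LinearIsometryEquiv.norm_map]
        _ = ε * (√(B / η) * n + D) * ‖k + u‖ := by
          rw [Finset.sum_add_distrib, ← Finset.sum_mul, Finset.sum_const, Finset.card_univ,
            nsmul_eq_mul]
          ring
    exact absurd (le_of_mul_le_mul_right h2 hxn) (not_le.2 hεb)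
  · rw [map_sum, Finset.sum_congr rfl fun q _ => hinv γ q]
    exact Fintype.sum_equiv (MulAction.toPerm γ) _ _ fun q => rfl

/-! ### Sums over words, group elements and triples -/

section Upsilon

variable {α : Type u} (T : Set (FreeGroup α))
  (R : Finset (List (α × Bool) × List (α × Bool) × List (α × Bool)))

theorem evalWord_append (u w : List (α × Bool)) :
    evalWord T (u ++ w) = evalWord T u * evalWord T w := by
  rw [evalWord, ← FreeGroup.mul_mk, map_mul]; rfl

theorem evalWord_invRev (w : List (α × Bool)) :
    evalWord T (FreeGroup.invRev w) = (evalWord T w)⁻¹ := by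
  rw [evalWord, ← FreeGroup.inv_mk, map_inv]; rfl

theorem invRev_mem_upsilonVertices {w : List (α × Bool)} (hw : w ∈ upsilonVertices R) :
    FreeGroup.invRev w ∈ upsilonVertices R := by
  classical
  rw [upsilonVertices, Finset.mem_union, Finset.mem_image] at hw ⊢
  rcases hw with hw | ⟨v, hv, rfl⟩
  · exact Or.inr ⟨w, hw, rfl⟩
  · exact Or.inl (by rwa [FreeGroup.invRev_invRev])

open Classical in
/-- The group elements represented by the vertices of `Υ`. -/
noncomputable def upsilonValues : Finset (PresentedGroup T) :=
  Finset.univ.image fun w : {w // w ∈ upsilonVertices R} => evalWord T w.1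

theorem mem_upsilonValues {g : PresentedGroup T} :
    g ∈ upsilonValues T R ↔ ∃ w ∈ upsilonVertices R, evalWord T w = g := by
  classical
  simp [upsilonValues]

theorem inv_mem_upsilonValues {g : PresentedGroup T} :
    g⁻¹ ∈ upsilonValues T R ↔ g ∈ upsilonValues T R := by
  have key (g : PresentedGroup T) (h : g ∈ upsilonValues T R) : g⁻¹ ∈ upsilonValues T R := by
    rw [mem_upsilonValues] at h ⊢
    obtain ⟨w, hw, rfl⟩ := h
    exact ⟨_, invRev_mem_upsilonVertices R hw, evalWord_invRev T w⟩
  exact ⟨fun h => by simpa using key _ h, key g⟩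

/-- Grouping words by value is needed because the bounds by `ε` and `δ` compare group elements, not
individual words. -/
theorem sum_deg_smul_evalWord {X : Type*} [AddCommGroup X] [Module ℝ X]
    (Φ : PresentedGroup T → X) :
    ∑ w, ((upsilon R).deg w : ℝ) • Φ (evalWord T w.1) =
      ∑ g ∈ upsilonValues T R, (groupDeg T R g : ℝ) • Φ g := by
  classical
  rw [← Finset.sum_fiberwise_of_maps_to (t := upsilonValues T R)
    (g := fun w : {w // w ∈ upsilonVertices R} => evalWord T w.1)
    fun w _ => (mem_upsilonValues T R).2 ⟨w.1, w.2, rfl⟩]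
  refine Finset.sum_congr rfl fun g _ => ?_
  rw [groupDeg, Nat.cast_sum, Finset.sum_smul]
  exact Finset.sum_congr (by congr) fun w hw => by rw [(Finset.mem_filter.1 hw).2]

theorem sum_wordRep_mul_evalWord (Φ : PresentedGroup T → ℝ) :
    ∑ w : {w // w ∈ upsilonVertices R}, (wordRep R w.1 : ℝ) * Φ (evalWord T w.1) =
      ∑ g ∈ upsilonValues T R, (groupRep T R g : ℝ) * Φ g := by
  classical
  rw [← Finset.sum_fiberwise_of_maps_to (t := upsilonValues T R)
    (g := fun w : {w // w ∈ upsilonVertices R} => evalWord T w.1)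
    fun w _ => (mem_upsilonValues T R).2 ⟨w.1, w.2, rfl⟩]
  refine Finset.sum_congr rfl fun g _ => ?_
  rw [groupRep, Nat.cast_sum, Finset.sum_mul]
  exact Finset.sum_congr (by congr) fun w hw => by rw [(Finset.mem_filter.1 hw).2]

theorem snd_mem_upsilonVertices {r : List (α × Bool) × List (α × Bool) × List (α × Bool)}
    (hr : r ∈ R) : r.2.1 ∈ upsilonVertices R := by
  classical
  exact Finset.mem_union_left _ (Finset.mem_union_left _
    (Finset.mem_union_right _ (Finset.mem_image_of_mem (fun r => r.2.1) hr)))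

/-- Each triple is counted twice by `rep`: by its middle word and by the inverse of that word. -/
theorem sum_wordRep_mul (F : List (α × Bool) → ℝ) :
    ∑ w : {w // w ∈ upsilonVertices R}, (wordRep R w.1 : ℝ) * F w.1 =
      ∑ r ∈ R, (F r.2.1 + F (FreeGroup.invRev r.2.1)) := by
  classical
  have hcard (w : List (α × Bool)) :
      (Nat.card {r // r ∈ R ∧ r.2.1 = w} : ℝ) = ∑ r ∈ R, if r.2.1 = w then 1 else 0 := by
    rw [Finset.sum_boole, Nat.subtype_card (R.filter fun r => r.2.1 = w) (by simp)]
  simp only [wordRep, Nat.cast_add, hcard, add_mul, Finset.sum_add_distrib, Finset.sum_mul]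
  rw [Finset.sum_coe_sort (upsilonVertices R)
      (fun w => ∑ r ∈ R, (if r.2.1 = w then (1 : ℝ) else 0) * F w),
    Finset.sum_coe_sort (upsilonVertices R)
      (fun w => ∑ r ∈ R, (if r.2.1 = FreeGroup.invRev w then (1 : ℝ) else 0) * F w),
    Finset.sum_comm, Finset.sum_comm (s := upsilonVertices R)]
  congr 1
  · refine Finset.sum_congr rfl fun r hr => ?_
    simp [snd_mem_upsilonVertices R hr]
  · refine Finset.sum_congr rfl fun r hr => ?_
    have (w : List (α × Bool)) : r.2.1 = FreeGroup.invRev w ↔ FreeGroup.invRev r.2.1 = w :=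
      ⟨fun h => by rw [h, FreeGroup.invRev_invRev], fun h => by rw [← h, FreeGroup.invRev_invRev]⟩
    simp [this, invRev_mem_upsilonVertices R (snd_mem_upsilonVertices R hr)]

theorem sum_deg_upsilon : ∑ w, ((upsilon R).deg w : ℝ) = 2 * R.card := by
  have := (upsilon R).sum_deg_mul (fun _ => 1)
  simpa [mul_comm] using this

theorem deg_upsilon_pos (e : {r // r ∈ R} × Bool) : 0 < (upsilon R).deg ((upsilon R).src e) :=
  Nat.card_pos_iff.2 ⟨⟨⟨e, rfl⟩⟩, inferInstance⟩

end Upsilon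

/-! ### Laplacians of weighted families of group elements -/

section GroupLaplacian

variable {G : Type*} [Group G] {ι : Type*} [Fintype ι] {H : Type*} [NormedAddCommGroup H]
  [InnerProductSpace ℝ H]

/-- The Laplacian `v ↦ ∑ i, c i • (2 • v - π (g i) v - π (g i)⁻¹ v)` of a weighted family of group
elements in a representation. -/
noncomputable def groupLaplacian (π : G →* (H ≃ₗᵢ[ℝ] H)) (g : ι → G) (c : ι → ℝ) : H →L[ℝ] H :=
  ∑ i, c i • ((2 : ℝ) • ContinuousLinearMap.id ℝ H -
    (π (g i)).toContinuousLinearEquiv.toContinuousLinearMap -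
    (π (g i)⁻¹).toContinuousLinearEquiv.toContinuousLinearMap)

variable (π : G →* (H ≃ₗᵢ[ℝ] H)) (g : ι → G) (c : ι → ℝ)

theorem groupLaplacian_apply (v : H) :
    groupLaplacian π g c v = ∑ i, c i • ((2 : ℝ) • v - π (g i) v - π (g i)⁻¹ v) := by
  simp only [groupLaplacian, FunLike.coe_sum, Finset.sum_apply]
  rfl

theorem groupLaplacian_symm (u v : H) :
    ⟪groupLaplacian π g c u, v⟫_ℝ = ⟪u, groupLaplacian π g c v⟫_ℝ := by
  have h (a : G) : ⟪π a u, v⟫_ℝ = ⟪u, π a⁻¹ v⟫_ℝ := by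
    rw [← linearIsometryEquiv_inner_map_inv, inv_inv]
  simp only [groupLaplacian_apply, sum_inner, inner_sum, real_inner_smul_left,
    real_inner_smul_right, inner_sub_left, inner_sub_right, h, inv_inv]
  exact Finset.sum_congr rfl fun i _ => by ring

theorem inner_groupLaplacian_self (v : H) :
    ⟪groupLaplacian π g c v, v⟫_ℝ = ∑ i, c i * ‖π (g i) v - v‖ ^ 2 := by
  simp only [groupLaplacian_apply, sum_inner, real_inner_smul_left, inner_sub_left,
    linearIsometryEquiv_inner_map_inv, norm_sub_sq_real, LinearIsometryEquiv.norm_map,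
    real_inner_self_eq_norm_sq]
  exact Finset.sum_congr rfl fun i _ => by rw [real_inner_comm v (π (g i) v)]; ring

/-- The energy `⟨Av, v⟩` is a sum of nonnegative terms, so all of them vanish; positive weight then
forces zero displacement. -/
theorem map_eq_self_of_groupLaplacian_eq_zero (hc : ∀ i, 0 ≤ c i) {v : H}
    (hv : groupLaplacian π g c v = 0) {i : ι} (hi : 0 < c i) : π (g i) v = v := by
  have h := inner_groupLaplacian_self π g c v
  rw [hv, inner_zero_left, eq_comm, Finset.sum_eq_zero_iff_of_nonneg
    fun i _ => mul_nonneg (hc i) (sq_nonneg _)] at h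
  have h1 := (mul_eq_zero.1 (h i (Finset.mem_univ i))).resolve_left hi.ne'
  exact sub_eq_zero.1 (norm_eq_zero.1 (pow_eq_zero_iff two_ne_zero |>.1 h1))

end GroupLaplacian

theorem norm_map_inv_sub {G : Type*} [Group G] {H : Type*} [NormedAddCommGroup H]
    [InnerProductSpace ℝ H] (π : G →* (H ≃ₗᵢ[ℝ] H)) (g : G) (v : H) :
    ‖π g⁻¹ v - v‖ = ‖π g v - v‖ := by
  rw [← (π g).norm_map (π g⁻¹ v - v), map_sub, ← linearIsometryEquiv_map_mul_apply, norm_sub_rev]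
  simp

/-! ### The energy estimate for representations that kill the relators -/

section UpsilonRepresentation

variable {α : Type u} (T : Set (FreeGroup α))
  (R : Finset (List (α × Bool) × List (α × Bool) × List (α × Bool)))
  {H : Type*} [NormedAddCommGroup H] [InnerProductSpace ℝ H]
  (π : PresentedGroup T →* (H ≃ₗᵢ[ℝ] H))

/-- The Laplacian of the vertices of `Υ`, weighted by their degrees. -/
noncomputable def upsilonLaplacian : H →L[ℝ] H :=
  groupLaplacian π (fun w : {w // w ∈ upsilonVertices R} => evalWord T w.1)
    (fun w => ((upsilon R).deg w : ℝ))

/-- Along the edge of a triple the orbit map moves as much as under its middle word. -/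
theorem sum_edges_norm_sq (hπ : ∀ g ∈ tripleRelators T R, π g = 1) (v : H) :
    ∑ e, ‖(π (evalWord T ((upsilon R).src e).1) v - v) -
        (π (evalWord T ((upsilon R).tgt e).1) v - v)‖ ^ 2 =
      2 * ∑ r ∈ R, ‖π (evalWord T r.2.1) v - v‖ ^ 2 := by
  have key (r : {r // r ∈ R}) :
      ‖π (evalWord T r.1.1) v - π (evalWord T (FreeGroup.invRev r.1.2.2)) v‖ =
        ‖π (evalWord T r.1.2.1) v - v‖ := by
    have h1 : π (evalWord T (FreeGroup.invRev r.1.2.2)) =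
        π (evalWord T r.1.1 * evalWord T r.1.2.1) := by
      have h2 := hπ _ ⟨r.1, r.2, rfl⟩
      rw [evalWord_append, evalWord_append, map_mul] at h2
      rw [evalWord_invRev, map_inv, ← mul_eq_one_iff_eq_inv.1 h2]
    rw [h1, linearIsometryEquiv_map_mul_apply, ← map_sub, LinearIsometryEquiv.norm_map,
      norm_sub_rev]
  rw [Fintype.sum_prod_type, ← Finset.sum_coe_sort R, Finset.mul_sum]
  refine Finset.sum_congr rfl fun r _ => ?_
  rw [Fintype.sum_bool, sub_sub_sub_cancel_right, sub_sub_sub_cancel_right]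
  simp only [upsilon, cond_true, cond_false]
  rw [norm_sub_rev, key]
  ring

variable {T R} {ε δ : ℝ}

/-- The weighted sum of the cocycle is the Laplacian up to the asymmetry of the degrees. -/
theorem norm_sum_deg_smul_sq_le (hε : 0 ≤ ε)
    (hdeg : ∀ g : PresentedGroup T, (∃ w ∈ upsilonVertices R, evalWord T w = g) →
      (groupDeg T R g : ℝ) ≤ (1 + ε) * (groupDeg T R g⁻¹ : ℝ)) (v : H) :
    ‖∑ w, ((upsilon R).deg w : ℝ) • (π (evalWord T w.1) v - v)‖ ^ 2 ≤
      ‖upsilonLaplacian T R π v‖ ^ 2 / 2 + ε ^ 2 / 2 * ((∑ w, ((upsilon R).deg w : ℝ)) *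
        ∑ w, ((upsilon R).deg w : ℝ) * ‖π (evalWord T w.1) v - v‖ ^ 2) := by
  set b : PresentedGroup T → H := fun g => π g v - v with hb
  set d : PresentedGroup T → ℝ := fun g => groupDeg T R g with hd
  set m : H := ∑ g ∈ upsilonValues T R, d g • b g with hm
  have hm' : ∑ w, ((upsilon R).deg w : ℝ) • (π (evalWord T w.1) v - v) = m :=
    sum_deg_smul_evalWord T R b
  have hflip (F : PresentedGroup T → H) :
      ∑ g ∈ upsilonValues T R, F g⁻¹ = ∑ g ∈ upsilonValues T R, F g :=
    Finset.sum_bij' (fun g _ => g⁻¹) (fun g _ => g⁻¹)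
      (fun g hg => (inv_mem_upsilonValues T R).2 hg) (fun g hg => (inv_mem_upsilonValues T R).2 hg)
      (by simp) (by simp) (by simp)
  have hA : upsilonLaplacian T R π v =
      -(m + ∑ g ∈ upsilonValues T R, d g⁻¹ • b g) := by
    rw [← hflip (fun g => d g⁻¹ • b g), hm, upsilonLaplacian, groupLaplacian_apply,
      sum_deg_smul_evalWord T R (fun g => (2 : ℝ) • v - π g v - π g⁻¹ v),
      ← Finset.sum_add_distrib, ← Finset.sum_neg_distrib]
    refine Finset.sum_congr rfl fun g _ => ?_
    simp only [hb, inv_inv, hd]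
    module
  -- `q` measures the asymmetry of the degrees: it vanishes when `d g = d g⁻¹` throughout.
  set q : H := ∑ g ∈ upsilonValues T R, (d g - d g⁻¹) • b g with hq
  have h2m : (2 : ℝ) • m = q - upsilonLaplacian T R π v := by
    rw [hA, hq]
    simp only [sub_smul, Finset.sum_sub_distrib, ← hm]
    module
  have hE : ∑ w, ((upsilon R).deg w : ℝ) * ‖π (evalWord T w.1) v - v‖ ^ 2 =
      ∑ g ∈ upsilonValues T R, d g * ‖b g‖ ^ 2 :=
    sum_deg_smul_evalWord T R (fun g => ‖b g‖ ^ 2)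
  have hD : ∑ w, ((upsilon R).deg w : ℝ) = ∑ g ∈ upsilonValues T R, d g := by
    simpa using sum_deg_smul_evalWord T R (fun _ => (1 : ℝ))
  have hd0 (g : PresentedGroup T) : 0 ≤ d g := Nat.cast_nonneg _
  -- `|d g - d g⁻¹| ≤ ε d g`: one sign is the hypothesis at `g⁻¹`; the other is the hypothesis at
  -- `g`, used when `d g⁻¹ ≤ d g`.
  have hqn : ‖q‖ ≤ ε * ∑ g ∈ upsilonValues T R, d g * ‖b g‖ := by
    rw [hq, Finset.mul_sum]
    refine (norm_sum_le _ _).trans (Finset.sum_le_sum fun g hg => ?_)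
    rw [norm_smul, ← mul_assoc]
    refine mul_le_mul_of_nonneg_right ?_ (norm_nonneg _)
    have h1 := hdeg g ((mem_upsilonValues T R).1 hg)
    have h2 := hdeg g⁻¹ ((mem_upsilonValues T R).1 ((inv_mem_upsilonValues T R).2 hg))
    rw [inv_inv] at h2
    rw [Real.norm_eq_abs, abs_le]
    have h3 := hd0 g
    have h4 := hd0 g⁻¹
    simp only [hd] at h3 h4 ⊢
    constructor
    · linarith
    · rcases le_total (groupDeg T R g : ℝ) (groupDeg T R g⁻¹ : ℝ) with h | h
      · have := mul_nonneg hε h3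
        linarith
      · have := mul_le_mul_of_nonneg_left h hε
        linarith
  have hcs : (∑ g ∈ upsilonValues T R, d g * ‖b g‖) ^ 2 ≤
      (∑ g ∈ upsilonValues T R, d g) * ∑ g ∈ upsilonValues T R, d g * ‖b g‖ ^ 2 :=
    Finset.sum_sq_le_sum_mul_sum_of_sq_le_mul _ (fun g _ => hd0 g)
      (fun g _ => mul_nonneg (hd0 g) (sq_nonneg _)) fun g _ => le_of_eq (by ring)
  have hq2 : ‖q‖ ^ 2 ≤ ε ^ 2 * ((∑ g ∈ upsilonValues T R, d g) *
      ∑ g ∈ upsilonValues T R, d g * ‖b g‖ ^ 2) := by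
    refine (pow_le_pow_left₀ (norm_nonneg q) hqn 2).trans ?_
    rw [mul_pow]
    exact mul_le_mul_of_nonneg_left hcs (sq_nonneg _)
  have hm2 : 2 * ‖m‖ ≤ ‖q‖ + ‖upsilonLaplacian T R π v‖ := by
    have := norm_sub_le q (upsilonLaplacian T R π v)
    rwa [← h2m, norm_smul, Real.norm_two] at this
  rw [hm', hE, hD]
  have h5 := pow_le_pow_left₀ (by positivity) hm2 2
  nlinarith [sq_nonneg (‖q‖ - ‖upsilonLaplacian T R π v‖)]

/-- The spectral gap of `Υ` bounds the displacement energy by the square of the Laplacian. -/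
theorem mul_inner_upsilonLaplacian_le (hε : 0 ≤ ε)
    (hdeg : ∀ g : PresentedGroup T, (∃ w ∈ upsilonVertices R, evalWord T w = g) →
      (groupDeg T R g : ℝ) ≤ (1 + ε) * (groupDeg T R g⁻¹ : ℝ))
    (hrep : ∀ g : PresentedGroup T, (∃ w ∈ upsilonVertices R, evalWord T w = g) →
      (groupRep T R g : ℝ) ≤ (1 + δ) * (groupDeg T R g : ℝ))
    (hpos : 0 < upsilonLambdaOne R) (hD : 0 < ∑ w, ((upsilon R).deg w : ℝ))
    (hπ : ∀ g ∈ tripleRelators T R, π g = 1) (v : H) :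
    (upsilonLambdaOne R * (2 - ε ^ 2) - (1 + δ)) * (∑ w, ((upsilon R).deg w : ℝ)) *
        ⟪upsilonLaplacian T R π v, v⟫_ℝ ≤
      upsilonLambdaOne R * ‖upsilonLaplacian T R π v‖ ^ 2 := by
  have hP := (upsilon R).poincare (upsilon_adjMatrix_symm R) hpos hD
    (fun w => π (evalWord T w.1) v - v)
  rw [sum_edges_norm_sq T R π hπ v] at hP
  have hM := norm_sum_deg_smul_sq_le π hε hdeg v
  have hE := inner_groupLaplacian_self π
    (fun w : {w // w ∈ upsilonVertices R} => evalWord T w.1)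
    (fun w => ((upsilon R).deg w : ℝ)) v
  change ⟪upsilonLaplacian T R π v, v⟫_ℝ = _ at hE
  change upsilonLambdaOne R * _ ≤ _ at hP
  rw [← hE] at hM hP
  -- `b(y)` and `b(y⁻¹)` have equal norm, so the factor `2` matches the double count in `rep`.
  have hY : 2 * ∑ r ∈ R, ‖π (evalWord T r.2.1) v - v‖ ^ 2 ≤
      (1 + δ) * ⟪upsilonLaplacian T R π v, v⟫_ℝ := by
    have h1 := sum_wordRep_mul R (fun w => ‖π (evalWord T w) v - v‖ ^ 2)
    have h2 := sum_wordRep_mul_evalWord T R (fun g => ‖π g v - v‖ ^ 2)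
    have h3 := sum_deg_smul_evalWord T R (fun g => ‖π g v - v‖ ^ 2)
    simp only [smul_eq_mul] at h3
    simp only [evalWord_invRev, norm_map_inv_sub, ← two_mul, ← Finset.mul_sum] at h1
    rw [← h1, h2, hE, h3, Finset.mul_sum]
    refine Finset.sum_le_sum fun g hg => ?_
    rw [← mul_assoc]
    exact mul_le_mul_of_nonneg_right (hrep g ((mem_upsilonValues T R).1 hg)) (sq_nonneg _)
  set l := upsilonLambdaOne R
  set D := ∑ w, ((upsilon R).deg w : ℝ)
  set E := ⟪upsilonLaplacian T R π v, v⟫_ℝ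
  set a := ‖upsilonLaplacian T R π v‖ ^ 2
  set s := ‖∑ w, ((upsilon R).deg w : ℝ) • (π (evalWord T w.1) v - v)‖ ^ 2
  have h4 : l * (E * D - s) ≤ (1 + δ) * E / 2 * D := by
    calc l * (E * D - s) = l * (E - s / D) * D := by field_simp
      _ ≤ _ := mul_le_mul_of_nonneg_right (by linarith) hD.le
  have h5 := mul_le_mul_of_nonneg_left hM hpos.le
  linarith

/-- The words of the triples fix the kernel of the Laplacian: by the bound on `rep`, the middle words
represent elements of positive degree. -/
theorem map_evalWord_eq_self_of_upsilonLaplacian_eq_zero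
    (hrep : ∀ g : PresentedGroup T, (∃ w ∈ upsilonVertices R, evalWord T w = g) →
      (groupRep T R g : ℝ) ≤ (1 + δ) * (groupDeg T R g : ℝ))
    {v : H} (hv : upsilonLaplacian T R π v = 0) {w : List (α × Bool)} (hw : w ∈ tripleWords R) :
    π (evalWord T w) v = v := by
  classical
  have hvertex (w : {w // w ∈ upsilonVertices R}) (hpos : 0 < (upsilon R).deg w) :
      π (evalWord T w.1) v = v :=
    map_eq_self_of_groupLaplacian_eq_zero π
      (fun w : {w // w ∈ upsilonVertices R} => evalWord T w.1) _
      (fun _ => Nat.cast_nonneg _) hv (Nat.cast_pos.2 hpos)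
  rw [tripleWords, Finset.mem_union, Finset.mem_union, Finset.mem_image, Finset.mem_image,
    Finset.mem_image] at hw
  rcases hw with (⟨r, hr, rfl⟩ | ⟨r, hr, rfl⟩) | ⟨r, hr, rfl⟩
  · exact hvertex _ (deg_upsilon_pos R (⟨r, hr⟩, false))
  -- A middle word may itself have degree `0` in `Υ`; the bound on `rep` supplies another word of
  -- positive degree with the same value.
  · have hmem := snd_mem_upsilonVertices R hr
    have hrep_pos : 0 < groupRep T R (evalWord T r.2.1) := by
      have h1 : 0 < wordRep R r.2.1 :=
        Nat.add_pos_left (Nat.card_pos_iff.2 ⟨⟨⟨r, hr, rfl⟩⟩,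
          Set.Finite.subset R.finite_toSet fun x hx => hx.1⟩) _
      exact h1.trans_le (Finset.single_le_sum
        (f := fun w : {w // w ∈ upsilonVertices R} => wordRep R w.1) (a := ⟨r.2.1, hmem⟩)
        (fun _ _ => Nat.zero_le _) (Finset.mem_filter.2 ⟨Finset.mem_univ _, rfl⟩))
    have h2 := hrep _ ⟨_, hmem, rfl⟩
    have h3 : groupDeg T R (evalWord T r.2.1) ≠ 0 := fun h => by
      rw [h, Nat.cast_zero, mul_zero] at h2
      exact absurd h2 (not_le.2 (Nat.cast_pos.2 hrep_pos))
    obtain ⟨w, hw, hw0⟩ := Finset.exists_ne_zero_of_sum_ne_zero h3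
    rw [← (Finset.mem_filter.1 hw).2]
    exact hvertex w (Nat.pos_of_ne_zero hw0)
  · have h1 : π (evalWord T (FreeGroup.invRev r.2.2)) v = v :=
      hvertex _ (deg_upsilon_pos R (⟨r, hr⟩, true))
    have h2 := norm_map_inv_sub π (evalWord T r.2.2) v
    rw [← evalWord_invRev, h1, sub_self, norm_zero, eq_comm, norm_eq_zero, sub_eq_zero] at h2
    exact h2

end UpsilonRepresentation

/-! ### The spectral criterion and Property (T) -/

/-- The underlying real representation of a complex unitary representation. -/
noncomputable def realRepresentation {Γ : Type*} [Group Γ] {H : Type*} [NormedAddCommGroup H]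
    [InnerProductSpace ℂ H] (π : Γ →* (H ≃ₗᵢ[ℂ] H)) : Γ →* (H ≃ₗᵢ[ℝ] H) where
  toFun g := ⟨(π g).toLinearEquiv.restrictScalars ℝ, (π g).norm_map⟩
  map_one' := by ext x; simp
  map_mul' a b := by ext x; simp; rfl

/-- The spectral criterion for a real orthogonal representation of the quotient by the relators. -/
theorem exists_invariant_of_lt_upsilonLambdaOne {α : Type u} {T : Set (FreeGroup α)}
    {R : Finset (List (α × Bool) × List (α × Bool) × List (α × Bool))}
    (hfin : (Subgroup.closure
      (evalWord T '' (tripleWords R : Set (List (α × Bool))))).FiniteIndex)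
    {ε δ : ℝ} (hε : 0 < ε) (hδ : 0 < δ) (hε2 : 0 < 2 - 4 * ε ^ 2)
    (hdeg : ∀ g : PresentedGroup T, (∃ w ∈ upsilonVertices R, evalWord T w = g) →
      (groupDeg T R g : ℝ) ≤ (1 + ε) * (groupDeg T R g⁻¹ : ℝ))
    (hrep : ∀ g : PresentedGroup T, (∃ w ∈ upsilonVertices R, evalWord T w = g) →
      (groupRep T R g : ℝ) ≤ (1 + δ) * (groupDeg T R g : ℝ))
    (hlam : (1 + δ) / (2 - 4 * ε ^ 2) < upsilonLambdaOne R)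
    {S : Set (PresentedGroup T ⧸ Subgroup.normalClosure (tripleRelators T R))}
    (hS : Subgroup.closure S = ⊤)
    {H : Type*} [NormedAddCommGroup H] [InnerProductSpace ℝ H] [CompleteSpace H]
    (ρ : PresentedGroup T ⧸ Subgroup.normalClosure (tripleRelators T R) →* (H ≃ₗᵢ[ℝ] H))
    (halmost : ∀ η : ℝ, 0 < η → ∃ x : H, x ≠ 0 ∧ ∀ s ∈ S, ‖ρ s x - x‖ < η * ‖x‖) :
    ∃ x : H, x ≠ 0 ∧ ∀ γ, ρ γ x = x := by
  classical
  have hpos : 0 < upsilonLambdaOne R := lt_trans (by positivity) hlam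
  have hD : 0 < ∑ w, ((upsilon R).deg w : ℝ) := by
    rw [sum_deg_upsilon]
    rcases R.eq_empty_or_nonempty with h | h
    -- With no triples there are no vertices, and the default value `0` contradicts `λ₁ > 0`.
    · subst h
      have hcard : ¬ 1 < Fintype.card {w // w ∈ upsilonVertices
          (∅ : Finset (List (α × Bool) × List (α × Bool) × List (α × Bool)))} := by
        rw [Fintype.card_coe]
        simp [upsilonVertices, tripleWords]
      rw [upsilonLambdaOne, secondSmallestEigenvalue, dif_neg hcard] at hpos
      exact absurd hpos (lt_irrefl _)
    · have := h.card_pos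
      positivity
  -- The argument needs only `2 - ε²`, which is at least the assumed `2 - 4ε²`.
  have hgap : 0 < upsilonLambdaOne R * (2 - ε ^ 2) - (1 + δ) := by
    rw [div_lt_iff₀ hε2] at hlam
    nlinarith [mul_nonneg hpos.le (sq_nonneg ε)]
  let p := QuotientGroup.mk' (Subgroup.normalClosure (tripleRelators T R))
  let σ : PresentedGroup T →* (H ≃ₗᵢ[ℝ] H) := ρ.comp p
  have hσ : ∀ g ∈ tripleRelators T R, σ g = 1 := fun g hg => by
    have : p g = 1 := (QuotientGroup.eq_one_iff g).2 (Subgroup.subset_normalClosure hg)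
    rw [MonoidHom.comp_apply, this, map_one]
  let A := upsilonLaplacian T R σ
  have hE (v : H) : ⟪A v, v⟫_ℝ =
      ∑ w, ((upsilon R).deg w : ℝ) * ‖σ (evalWord T w.1) v - v‖ ^ 2 :=
    inner_groupLaplacian_self σ _ _ v
  set η := (upsilonLambdaOne R * (2 - ε ^ 2) - (1 + δ)) * (∑ w, ((upsilon R).deg w : ℝ)) /
    upsilonLambdaOne R
  have hη : 0 < η := by positivity
  let N₀ := Subgroup.closure (evalWord T '' (tripleWords R : Set (List (α × Bool))))
  -- Under a surjection the index of the image divides the original index.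
  have hN : (N₀.map p).FiniteIndex :=
    ⟨ne_zero_of_dvd_ne_zero hfin.index_ne_zero
      (N₀.index_map_dvd (QuotientGroup.mk'_surjective _))⟩
  have hK : ∀ k ∈ A.ker, ∀ n ∈ N₀.map p, ρ n k = k := by
    rintro k hk _ ⟨n, hn, rfl⟩
    change σ n k = k
    induction hn using Subgroup.closure_induction with
    | mem g hg =>
      obtain ⟨w, hw, rfl⟩ := hg
      exact map_evalWord_eq_self_of_upsilonLaplacian_eq_zero σ hrep hk hw
    | one => simp
    | mul a b _ _ ha hb => rw [linearIsometryEquiv_map_mul_apply, hb, ha]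
    | inv a _ ha =>
      have h := norm_map_inv_sub σ a k
      rwa [ha, sub_self, norm_zero, norm_eq_zero, sub_eq_zero] at h
  have : CompleteSpace A.ker := A.isClosed_ker.completeSpace_coe
  have hmem (w : {w // w ∈ upsilonVertices R}) : p (evalWord T w.1) ∈ N₀.map p := by
    refine Subgroup.mem_map_of_mem p ?_
    rcases Finset.mem_union.1 w.2 with hw | hw
    · exact Subgroup.subset_closure ⟨_, hw, rfl⟩
    · obtain ⟨u, hu, h⟩ := Finset.mem_image.1 hw
      rw [← h, evalWord_invRev]
      exact inv_mem (Subgroup.subset_closure ⟨_, hu, rfl⟩)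
  exact exists_invariant_of_finiteIndex_of_gap ρ hS halmost (N₀.map p) A.ker hK
    (fun w : {w // w ∈ upsilonVertices R} => p (evalWord T w.1)) hmem
    (fun w => ((upsilon R).deg w : ℝ)) (fun _ => Nat.cast_nonneg _) hη fun u hu => by
      refine (mul_norm_sq_le_inner_of_mem_orthogonal_ker A (groupLaplacian_symm σ _ _)
        (fun v => ?_) hη (fun v => ?_) u hu).trans_eq (hE u)
      · rw [hE]
        positivity
      · rw [div_mul_eq_mul_div, div_le_iff₀ hpos, mul_comm (‖A v‖ ^ 2)]
        exact mul_inner_upsilonLaplacian_le σ hε.le hdeg hrep hpos hD hσ v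

theorem mainTheorem3 {α : Type u} [Finite α] (T : Set (FreeGroup α)) (hT : T.Finite)
    (hyp : IsHyperbolicPresentation T)
    (L : Language (α × Bool)) (hL : IsAdmissibleLanguage T L)
    (R : Finset (List (α × Bool) × List (α × Bool) × List (α × Bool)))
    (hR : IsAdmissibleTriples L R)
    (hfin : (Subgroup.closure
      (evalWord T '' (tripleWords R : Set (List (α × Bool))))).FiniteIndex)
    (ε δ : ℝ) (hε : 0 < ε) (hδ : 0 < δ) (hε2 : 0 < 2 - 4 * ε ^ 2)
    (hdeg : ∀ g : PresentedGroup T, (∃ w ∈ upsilonVertices R, evalWord T w = g) →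
      (groupDeg T R g : ℝ) ≤ (1 + ε) * (groupDeg T R g⁻¹ : ℝ))
    (hrep : ∀ g : PresentedGroup T, (∃ w ∈ upsilonVertices R, evalWord T w = g) →
      (groupRep T R g : ℝ) ≤ (1 + δ) * (groupDeg T R g : ℝ))
    (hlam : (1 + δ) / (2 - 4 * ε ^ 2) < upsilonLambdaOne R) :
    HasPropertyT.{u, v} (PresentedGroup T ⧸ Subgroup.normalClosure (tripleRelators T R)) := by
  have : Group.FG (PresentedGroup T) :=
    Group.fg_of_surjective (PresentedGroup.mk_surjective T)
  refine ⟨inferInstance, fun S hS H _ _ _ π halmost => ?_⟩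
  let _ : InnerProductSpace ℝ H := InnerProductSpace.complexToReal
  exact exists_invariant_of_lt_upsilonLambdaOne hfin hε hδ hε2 hdeg hrep hlam hS
    (H := H) (ρ := realRepresentation π) halmost
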